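/- A temporal graph $\mathcal G=(V,E,\lambda)$ consists of a finite set $V$, a set $E$ of undirected edges (without loops) on $V$, and a map $\lambda$ assigning to every edge a non-empty set of time labels in $\mathbb N$. It is *simple* if every edge has exactly one label, *proper* if $\lambda(e)\cap\lambda(e')=\emptyset$ for all distinct edges $e,e'$ sharing a vertex, and *happy* if it is both simple and proper. A *journey* from $u$ to $v$ is a sequence $(e_1,t_1),\dots,(e_k,t_k)$, $k\ge 0$, with $t_i\in\lambda(e_i)$ and $t_1\le\dots\le t_k$, such that $e_1,\dots,e_k$ is a path from $u$ to $v$ in $(V,E)$. The graph $\mathcal G$ is *temporally connected* if there is a journey from $u$ to $v$ for all $u,v\in V$. A *temporal spanner* of $\mathcal G$ is a temporally connected temporal graph $(V,E',\lambda')$ with $E'\subseteq E$ and $\lambda'(e)\subseteq\lambda(e)$ for all $e\in E'$. **Theorem.** (1) For every even $n\ge 2$ there is a happy, temporally connected temporal graph $\mathcal G=(V,E,\lambda)$ with $|V|=3n$, with $|E|=\frac{n(n+9)}2-3$, and with lifetime at most $\frac{n(n+5)}2-1$, that is, all labels lie in $\{1,\dots,\frac{n(n+5)}2-1\}$, such that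 for every set $S\subseteq E$ with $|S|=5n$ the temporal graph obtained from $\mathcal G$ by removing the edges in $S$ (the other edges keep their labels) is not temporally connected. (2) Consequently, happy graphs do not always admit $o(N^2)$-sparse temporal spanners: there is no function $f:\mathbb N\to\mathbb R$ with $f(N)=o(N^2)$ such that every happy, temporally connected temporal graph on $N$ vertices has a temporal spanner with at most $f(N)$ edges. -/

import Mathlib

/-- A temporal graph on the vertex set `V`: an undirected loopless footprint whose edges carry
non-empty sets of time labels. The labelling is extended by `∅` to pairs that are not edges. -/
structure TemporalGraph (V : Type*) where
  /-- the footprint `(V, E)` -/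
  footprint : SimpleGraph V
  /-- the set of presence times of an edge -/
  label : Sym2 V → Set ℕ
  label_nonempty_iff : ∀ e, (label e).Nonempty ↔ e ∈ footprint.edgeSet

namespace TemporalGraph

/-- The set `E` of edges. -/
def edges {V : Type*} (G : TemporalGraph V) : Set (Sym2 V) := G.footprint.edgeSet

/-- The set of all time labels in use. -/
def lifetime {V : Type*} (G : TemporalGraph V) : Set ℕ :=
  {t | ∃ e ∈ G.edges, t ∈ G.label e}

/-- A journey (temporal path) along the walk `p`: a sequence `c` of contacts `(eᵢ, tᵢ)` whose edges
form the path `p` of the footprint and whose times are non-decreasing. -/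
def IsJourney {V : Type*} (G : TemporalGraph V) {u v : V} (p : G.footprint.Walk u v)
    (c : List (Sym2 V × ℕ)) : Prop :=
  p.IsPath ∧ c.map Prod.fst = p.edges ∧ (∀ x ∈ c, x.2 ∈ G.label x.1) ∧
    (c.map Prod.snd).Pairwise (· ≤ ·)

/-- `u` can reach `v` by a journey. -/
def CanReach {V : Type*} (G : TemporalGraph V) (u v : V) : Prop :=
  ∃ (p : G.footprint.Walk u v) (c : List (Sym2 V × ℕ)), G.IsJourney p c

/-- Every vertex can reach every vertex by a journey. -/
def TemporallyConnected {V : Type*} (G : TemporalGraph V) : Prop :=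
  ∀ u v : V, G.CanReach u v

/-- Distinct edges that share an end vertex have no common label. -/
def Proper {V : Type*} (G : TemporalGraph V) : Prop :=
  ∀ e ∈ G.edges, ∀ e' ∈ G.edges, e ≠ e' → (∃ v, v ∈ e ∧ v ∈ e') → Disjoint (G.label e) (G.label e')

/-- Every edge has exactly one label. -/
def Simple {V : Type*} (G : TemporalGraph V) : Prop :=
  ∀ e ∈ G.edges, ∃ t, G.label e = {t}

/-- A happy temporal graph is both proper and simple. -/
def Happy {V : Type*} (G : TemporalGraph V) : Prop := G.Proper ∧ G.Simple

open Classical in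
/-- The temporal graph obtained by removing the edges in `S`; the other edges keep their labels. -/
noncomputable def removeEdges {V : Type*} (G : TemporalGraph V) (S : Set (Sym2 V)) :
    TemporalGraph V where
  footprint := G.footprint.deleteEdges S
  label e := if e ∈ S then ∅ else G.label e
  label_nonempty_iff e := by
    by_cases h : e ∈ S <;> simp [h, G.label_nonempty_iff, SimpleGraph.edgeSet_deleteEdges]

/-- `H` is a temporal spanner of `G`: a temporally connected temporal graph on the same vertices
whose edges, and whose labels on each edge, are among those of `G`. -/
def IsSpanner {V : Type*} (H G : TemporalGraph V) : Prop :=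
  H.TemporallyConnected ∧ H.edges ⊆ G.edges ∧ ∀ e ∈ H.edges, H.label e ⊆ G.label e

end TemporalGraph

/-! The complete graph on `n = 2 * m` core vertices splits into `m` zigzag Hamiltonian paths
(`hamPath_edge_inj`). Path `i` gets increasing labels in a time window of its own and is flanked by
a private source and sink. Every journey from source `i` to sink `i` must traverse all of path `i`,
so none of the `n * (n - 1) / 2` core edges can be spared (`not_temporallyConnected_dense`). Only `5
* n - 3` further edges serve all other pairs without opening a second route
(`temporallyConnected_dense`). Hence any `5 * n` edges include an indispensable one.

Unreachability is certified by a function `a` on vertices: if each remaining contact at time `t` has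
`a ≤ t` at both ends or at neither, then `a` bounds arrival times from below (`CanReach.arrival_le`,
`arrival_le_iff`).

For the second claim, a spanner with `o(N ^ 2)` edges would leave `5 * n` removable edges
(`IsSpanner.exists_removeEdges`). -/

namespace TemporalGraph

/-- There is a journey from `u` to `v` that uses no label later than `t`. -/
def ReachBy {V : Type*} (G : TemporalGraph V) (u v : V) (t : ℕ) : Prop :=
  ∃ (p : G.footprint.Walk u v) (c : List (Sym2 V × ℕ)), G.IsJourney p c ∧ ∀ x ∈ c, x.2 ≤ t

/-! ### Journeys and lower bounds for arrival times -/

section General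

variable {V : Type*} {G : TemporalGraph V}

theorem ReachBy.canReach {u v : V} {t : ℕ} (h : G.ReachBy u v t) : G.CanReach u v := by
  obtain ⟨p, c, h, -⟩ := h
  exact ⟨p, c, h⟩

theorem ReachBy.refl (G : TemporalGraph V) (u : V) (t : ℕ) : G.ReachBy u u t :=
  ⟨.nil, [], by simp [IsJourney], by simp⟩

theorem ReachBy.mono {u v : V} {t s : ℕ} (h : G.ReachBy u v t) (hts : t ≤ s) :
    G.ReachBy u v s := by
  obtain ⟨p, c, h, ht⟩ := h
  exact ⟨p, c, h, fun x hx => (ht x hx).trans hts⟩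

theorem ReachBy.step {u v w : V} {t s : ℕ} (h : G.ReachBy u v t) (hs : s ∈ G.label s(v, w))
    (hts : t ≤ s) : G.ReachBy u w s := by
  classical
  obtain ⟨p, c, ⟨hp, hc, hl, hm⟩, ht⟩ := h
  -- If `w` is already on the path, appending it would repeat a vertex; the initial segment up to
  -- `w` is a journey that arrives early enough.
  by_cases hw : w ∈ p.support
  · have he : p.edges = (p.takeUntil w hw).edges ++ (p.dropUntil w hw).edges := by
      rw [← SimpleGraph.Walk.edges_append, SimpleGraph.Walk.take_spec]
    rw [he, List.map_eq_append_iff] at hc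
    obtain ⟨c₁, c₂, rfl, h₁, -⟩ := hc
    refine ⟨p.takeUntil w hw, c₁, ⟨hp.takeUntil hw, h₁, fun x hx => hl x (by simp [hx]), ?_⟩,
      fun x hx => (ht x (by simp [hx])).trans hts⟩
    rw [List.map_append, List.pairwise_append] at hm
    exact hm.1
  · have hadj : G.footprint.Adj v w := (G.label_nonempty_iff s(v, w)).1 ⟨s, hs⟩
    refine ⟨p.concat hadj, c ++ [(s(v, w), s)], ⟨hp.concat hw hadj, ?_, ?_, ?_⟩, ?_⟩
    · simp [hc, SimpleGraph.Walk.edges_concat]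
    · intro x hx
      rcases List.mem_append.1 hx with hx | hx
      · exact hl x hx
      · rw [List.mem_singleton.1 hx]; exact hs
    · rw [List.map_append, List.pairwise_append]
      refine ⟨hm, by simp, ?_⟩
      simp only [List.mem_map, List.map_cons, List.map_nil, List.mem_singleton]
      rintro a ⟨x, hx, rfl⟩ b rfl
      exact (ht x hx).trans hts
    · intro x hx
      rcases List.mem_append.1 hx with hx | hx
      · exact (ht x hx).trans hts
      · rw [List.mem_singleton.1 hx]

/-- If `a` is a lower bound for arrival times that is respected by all contacts, then
a vertex that can be reached has a value of `a` within the lifetime. -/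
theorem CanReach.arrival_le {a : V → ℕ} {M : ℕ} (hM : ∀ e, ∀ t ∈ G.label e, t ≤ M)
    (ha : ∀ v w, ∀ t ∈ G.label s(v, w), a v ≤ t → a w ≤ t) {u v : V} (h : G.CanReach u v)
    (hu : a u = 0) : a v ≤ M := by
  obtain ⟨p, c, -, hc, hl, hm⟩ := h
  -- The induction carries the current time `t₀`, which bounds `a` at the current vertex from above
  -- and all remaining contacts from below.
  suffices key : ∀ t₀ ≤ M, a u ≤ t₀ → (∀ x ∈ c, t₀ ≤ x.2) → a v ≤ M from
    key 0 (Nat.zero_le _) hu.le fun _ _ => Nat.zero_le _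
  clear hu
  induction p generalizing c with
  | nil => exact fun t₀ h₀ hu _ => hu.trans h₀
  | @cons u w v hadj p ih =>
    intro t₀ h₀ hu hx
    obtain _ | ⟨⟨e, s⟩, c⟩ := c
    · simp at hc
    · simp only [List.map_cons, SimpleGraph.Walk.edges_cons, List.cons.injEq] at hc
      obtain ⟨rfl, hc⟩ := hc
      have hs : s ∈ G.label s(u, w) := hl (s(u, w), s) (by simp)
      rw [List.map_cons, List.pairwise_cons] at hm
      refine ih c hc (fun x hx => hl x (by simp [hx])) hm.2 s (hM _ s hs)
        (ha u w s hs (hu.trans (hx (s(u, w), s) (by simp)))) fun x hx => ?_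
      exact hm.1 _ (List.mem_map_of_mem hx)

/-- Reachability is inherited by temporal graphs with more contacts. -/
theorem CanReach.mono {H : TemporalGraph V} {u v : V} (h : H.CanReach u v)
    (hHG : ∀ e, H.label e ⊆ G.label e) : G.CanReach u v := by
  obtain ⟨p, c, hp, hc, hl, hm⟩ := h
  have hle : H.footprint ≤ G.footprint := by
    intro a b hab
    obtain ⟨t, ht⟩ := (H.label_nonempty_iff s(a, b)).2 hab
    exact (G.label_nonempty_iff s(a, b)).1 ⟨t, hHG _ ht⟩
  refine ⟨p.mapLe hle, c, hp.mapLe hle, ?_, fun x hx => hHG _ (hl x hx), hm⟩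
  rw [hc, SimpleGraph.Walk.edges_mapLe_eq_edges]

theorem mem_label_removeEdges {S : Set (Sym2 V)} {e : Sym2 V} {t : ℕ} :
    t ∈ (G.removeEdges S).label e ↔ e ∉ S ∧ t ∈ G.label e := by
  by_cases he : e ∈ S <;> simp [removeEdges, he]

end General

/-! ### Temporal graphs given by an indexed family of contacts -/

section Family

variable {ι V : Type*}

/-- The temporal graph whose edges are the pairs `ends i`, present at the time `time i`. -/
def ofFamily (ends : ι → V × V) (time : ι → ℕ) (hne : ∀ i, (ends i).1 ≠ (ends i).2) :
    TemporalGraph V where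
  footprint := SimpleGraph.fromEdgeSet (Set.range fun i => s((ends i).1, (ends i).2))
  label e := {t | ∃ i, s((ends i).1, (ends i).2) = e ∧ time i = t}
  label_nonempty_iff e := by
    rw [SimpleGraph.edgeSet_fromEdgeSet]
    constructor
    · rintro ⟨t, i, rfl, -⟩
      exact ⟨⟨i, rfl⟩, by simpa using hne i⟩
    · rintro ⟨⟨i, rfl⟩, -⟩
      exact ⟨time i, i, rfl, rfl⟩

variable {ends : ι → V × V} {time : ι → ℕ} {hne : ∀ i, (ends i).1 ≠ (ends i).2}

theorem edges_ofFamily :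
    (ofFamily ends time hne).edges = Set.range fun i => s((ends i).1, (ends i).2) := by
  ext e
  rw [edges, ← label_nonempty_iff]
  constructor
  · rintro ⟨t, i, rfl, -⟩
    exact ⟨i, rfl⟩
  · rintro ⟨i, rfl⟩
    exact ⟨time i, i, rfl, rfl⟩

theorem ncard_edges_ofFamily (hinj : Function.Injective fun i => s((ends i).1, (ends i).2)) :
    (ofFamily ends time hne).edges.ncard = Nat.card ι := by
  rw [edges_ofFamily, ← Set.image_univ, Set.ncard_image_of_injective _ hinj, Set.ncard_univ]

theorem happy_ofFamily (hinj : Function.Injective fun i => s((ends i).1, (ends i).2))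
    (hproper : ∀ i j, time i = time j → (∃ v, v ∈ s((ends i).1, (ends i).2) ∧
      v ∈ s((ends j).1, (ends j).2)) → i = j) :
    (ofFamily ends time hne).Happy := by
  refine ⟨fun e _ e' _ hee hv => ?_, fun e he => ?_⟩
  · rw [Set.disjoint_left]
    rintro t ⟨i, rfl, rfl⟩ ⟨j, rfl, hij⟩
    exact hee (by rw [hproper i j hij.symm hv])
  · rw [edges_ofFamily] at he
    obtain ⟨i, rfl⟩ := he
    refine ⟨time i, Set.ext fun t => ⟨?_, ?_⟩⟩
    · rintro ⟨j, hj, rfl⟩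
      rw [Set.mem_singleton_iff, hinj hj]
    · rintro rfl
      exact ⟨i, rfl, rfl⟩

theorem lifetime_ofFamily_subset {s : Set ℕ} (h : ∀ i, time i ∈ s) :
    (ofFamily ends time hne).lifetime ⊆ s := by
  rintro t ⟨e, -, i, -, rfl⟩
  exact h i

theorem ReachBy.fwd {u v w : V} {t : ℕ} (h : (ofFamily ends time hne).ReachBy u v t) (i : ι)
    (hi : ends i = (v, w)) (ht : t ≤ time i) :
    (ofFamily ends time hne).ReachBy u w (time i) :=
  h.step ⟨i, by rw [hi], rfl⟩ ht

theorem ReachBy.bwd {u v w : V} {t : ℕ} (h : (ofFamily ends time hne).ReachBy u v t) (i : ι)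
    (hi : ends i = (w, v)) (ht : t ≤ time i) :
    (ofFamily ends time hne).ReachBy u w (time i) :=
  h.step ⟨i, by rw [hi, Sym2.eq_swap], rfl⟩ ht

/-- An edge of the family whose removal leaves an obstruction to reaching `v` from `u` cannot be
removed. -/
theorem not_temporallyConnected_of_barrier {S : Set (Sym2 V)} {i₀ : ι}
    (hS : s((ends i₀).1, (ends i₀).2) ∈ S) {M : ℕ} (hM : ∀ i, time i ≤ M) {a : V → ℕ}
    (ha : ∀ i, i ≠ i₀ → (a (ends i).1 ≤ time i ↔ a (ends i).2 ≤ time i)) {u v : V}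
    (hu : a u = 0) (hv : M < a v) :
    ¬ ((ofFamily ends time hne).removeEdges S).TemporallyConnected := by
  intro h
  refine hv.not_ge ((h u v).arrival_le ?_ ?_ hu)
  · intro e t ht
    obtain ⟨-, i, -, rfl⟩ := mem_label_removeEdges.1 ht
    exact hM i
  · intro x y t ht hx
    obtain ⟨hxy, i, hi, rfl⟩ := mem_label_removeEdges.1 ht
    have hi₀ : i ≠ i₀ := by
      rintro rfl
      exact hxy (hi ▸ hS)
    rcases Sym2.eq_iff.1 hi with ⟨rfl, rfl⟩ | ⟨rfl, rfl⟩
    · exact (ha i hi₀).1 hx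
    · exact (ha i hi₀).2 hx

end Family

end TemporalGraph

/-! ### Zigzag decomposition of the complete graph -/

/-- The sequence `0, 1, -1, 2, -2, …` of residues. -/
def zigzag (n p : ℕ) : ZMod n :=
  if Even p then -((p / 2 : ℕ) : ZMod n) else (((p + 1) / 2 : ℕ) : ZMod n)

/-- Positions of equal parity differ in absolute value. For opposite parities, equality would make
the sum of the two absolute values vanish modulo `2 * m`, but it lies strictly between `0` and `2 *
m`. -/
theorem zigzag_injOn {m p q : ℕ} (hp : p < 2 * m) (hq : q < 2 * m)
    (h : zigzag (2 * m) p = zigzag (2 * m) q) : p = q := by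
  have cast_inj : ∀ a b : ℕ, a < 2 * m → b < 2 * m → ((a : ZMod (2 * m)) = b) → a = b := by
    intro a b ha hb hab
    rw [ZMod.natCast_eq_natCast_iff] at hab
    exact Nat.ModEq.eq_of_lt_of_lt hab ha hb
  unfold zigzag at h
  split_ifs at h with hp' hq' hq' <;> simp only [Nat.even_iff] at hp' hq'
  · have := cast_inj _ _ (by omega) (by omega) (neg_injective h)
    omega
  · have := cast_inj (p / 2 + (q + 1) / 2) 0 (by omega) (by omega)
      (by push_cast; rw [← h]; simp)
    omega
  · have := cast_inj ((p + 1) / 2 + q / 2) 0 (by omega) (by omega)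
      (by push_cast; rw [h]; simp)
    omega
  · have := cast_inj _ _ (by omega) (by omega) h
    omega

/-- Identifies the path of an edge: after the shift by `i` the endpoint sum is `2 * i` or `2 * i +
1`, and for `i < m` these residues are distinct. -/
theorem zigzag_add_succ (n p : ℕ) :
    zigzag n p + zigzag n (p + 1) = (((p + 1) % 2 : ℕ) : ZMod n) := by
  unfold zigzag
  rcases Nat.even_or_odd' p with ⟨k, rfl | rfl⟩
  · have h₁ : 2 * k / 2 = k := by omega
    have h₂ : (2 * k + 1 + 1) / 2 = k + 1 := by omega
    have h₃ : (2 * k + 1) % 2 = 1 := by omega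
    simp [h₁, h₂, h₃]
  · have h₁ : (2 * k + 1 + 1) / 2 = k + 1 := by omega
    have h₃ : (2 * k + 1 + 1) % 2 = 0 := by omega
    simp [h₁, h₃, Nat.even_add_one]

/-- The `i`-th Hamiltonian path of the decomposition of the complete graph on `ZMod (2 * m)` into
zigzags, as a bijection from positions to vertices. -/
noncomputable def hamPath (m : ℕ) [NeZero (2 * m)] (i : ℕ) : Fin (2 * m) ≃ ZMod (2 * m) :=
  Equiv.ofBijective (fun p => (i : ZMod (2 * m)) + zigzag (2 * m) p) <| by
    rw [Fintype.bijective_iff_injective_and_card]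
    refine ⟨fun p q h => Fin.ext (zigzag_injOn p.2 q.2 (add_left_cancel h)), ?_⟩
    simp [ZMod.card]

theorem hamPath_apply (m : ℕ) [NeZero (2 * m)] (i : ℕ) (p : Fin (2 * m)) :
    hamPath m i p = (i : ZMod (2 * m)) + zigzag (2 * m) p := rfl

theorem natCast_zmod_inj {n a b : ℕ} (ha : a < n) (hb : b < n) :
    ((a : ZMod n) = b) ↔ a = b := by
  rw [ZMod.natCast_eq_natCast_iff]
  exact ⟨fun h => Nat.ModEq.eq_of_lt_of_lt h ha hb, fun h => h ▸ rfl⟩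

theorem hamPath_left_inj {m : ℕ} [NeZero (2 * m)] {i j : ℕ} (hi : i < m) (hj : j < m)
    (p : Fin (2 * m)) : hamPath m i p = hamPath m j p ↔ i = j := by
  rw [hamPath_apply, hamPath_apply, add_left_inj, natCast_zmod_inj (by omega) (by omega)]

/-- The zigzag Hamiltonian paths are edge-disjoint. -/
theorem hamPath_edge_inj {m : ℕ} [NeZero (2 * m)] {i j : ℕ} (hi : i < m) (hj : j < m)
    {p p' q q' : Fin (2 * m)} (hp : p'.1 = p.1 + 1) (hq : q'.1 = q.1 + 1)
    (h : s(hamPath m i p, hamPath m i p') = s(hamPath m j q, hamPath m j q')) :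
    i = j ∧ p = q := by
  have hsum : hamPath m i p + hamPath m i p' = hamPath m j q + hamPath m j q' := by
    rcases Sym2.eq_iff.1 h with ⟨h₁, h₂⟩ | ⟨h₁, h₂⟩
    · rw [h₁, h₂]
    · rw [h₁, h₂, add_comm]
  have aux : ∀ (i : ℕ) (p p' : Fin (2 * m)), p'.1 = p.1 + 1 →
      hamPath m i p + hamPath m i p' = ((2 * i + (p.1 + 1) % 2 : ℕ) : ZMod (2 * m)) := by
    intro i p p' hp
    rw [Nat.cast_add, ← zigzag_add_succ, hamPath_apply, hamPath_apply, hp]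
    push_cast
    ring
  rw [aux _ _ _ hp, aux _ _ _ hq, natCast_zmod_inj (by omega) (by omega)] at hsum
  obtain rfl : i = j := by omega
  refine ⟨rfl, ?_⟩
  rcases Sym2.eq_iff.1 h with ⟨h₁, h₂⟩ | ⟨h₁, h₂⟩
  · exact (hamPath m i).injective h₁
  -- Swapped ends would force `p = q + 1` and `q = p + 1`.
  · have h₁ := congrArg Fin.val ((hamPath m i).injective h₁)
    have h₂ := congrArg Fin.val ((hamPath m i).injective h₂)
    omega

namespace TemporalGraph

/-! ### Vertices, edges and labels of the dense example -/

namespace Dense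

/-- The vertices of the dense example with parameter `m = r + 2`: a core that carries `m`
edge-disjoint Hamiltonian paths, a source and a sink for each path, relays between the sources and
the sinks, and fillers. -/
inductive Vert (r : ℕ) : Type
  | core (k : ZMod (2 * (r + 2)))
  | source (i : Fin (r + 2))
  | sink (i : Fin (r + 2))
  | relay (i : Fin (r + 1))
  | filler (l : Fin (r + 3))

/-- Indices for the edges of the dense example. -/
inductive Edge (r : ℕ) : Type
  | sinkRelay (i : Fin (r + 1))
  | sourceRelay (i : Fin (r + 1))
  | relayRelay (i : Fin r)
  | fillerIn (l : Fin (r + 3))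
  | enter (i : Fin (r + 2))
  | path (i : Fin (r + 2)) (p : Fin (2 * r + 3))
  | leave (i : Fin (r + 2))
  | link (i : Fin (r + 1))
  | relayOut (i : Fin r)
  | sourceOut (i : Fin (r + 2))
  | fillerOut (l : Fin (r + 3))
  | rootOut (a : Fin 2)

variable {r : ℕ}

def vertEquiv (r : ℕ) : Vert r ≃
    ZMod (2 * (r + 2)) ⊕ Fin (r + 2) ⊕ Fin (r + 2) ⊕ Fin (r + 1) ⊕ Fin (r + 3) where
  toFun
    | .core k => .inl k
    | .source i => .inr (.inl i)
    | .sink i => .inr (.inr (.inl i))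
    | .relay i => .inr (.inr (.inr (.inl i)))
    | .filler i => .inr (.inr (.inr (.inr i)))
  invFun
    | .inl k => .core k
    | .inr (.inl i) => .source i
    | .inr (.inr (.inl i)) => .sink i
    | .inr (.inr (.inr (.inl i))) => .relay i
    | .inr (.inr (.inr (.inr i))) => .filler i
  left_inv := by rintro (_ | _ | _ | _ | _) <;> rfl
  right_inv := by rintro (_ | _ | _ | _ | _) <;> rfl

noncomputable instance : Fintype (Vert r) := Fintype.ofEquiv _ (vertEquiv r).symm

theorem card_vert (r : ℕ) : Fintype.card (Vert r) = 3 * (2 * (r + 2)) := by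
  rw [Fintype.card_congr (vertEquiv r)]
  simp [ZMod.card]
  ring

/-- The edges outside the Hamiltonian paths, together with the edges of these paths. -/
def edgeEquiv (r : ℕ) : Edge r ≃
    (Fin (r + 1) ⊕ Fin (r + 1) ⊕ Fin r ⊕ Fin (r + 3) ⊕ Fin (r + 2) ⊕ Fin (r + 2) ⊕ Fin (r + 1) ⊕
      Fin r ⊕ Fin (r + 2) ⊕ Fin (r + 3) ⊕ Fin 2) ⊕ Fin (r + 2) × Fin (2 * r + 3) where
  toFun
    | .sinkRelay i => .inl (.inl i)
    | .sourceRelay i => .inl (.inr (.inl i))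
    | .relayRelay i => .inl (.inr (.inr (.inl i)))
    | .fillerIn i => .inl (.inr (.inr (.inr (.inl i))))
    | .enter i => .inl (.inr (.inr (.inr (.inr (.inl i)))))
    | .leave i => .inl (.inr (.inr (.inr (.inr (.inr (.inl i))))))
    | .link i => .inl (.inr (.inr (.inr (.inr (.inr (.inr (.inl i)))))))
    | .relayOut i => .inl (.inr (.inr (.inr (.inr (.inr (.inr (.inr (.inl i))))))))
    | .sourceOut i => .inl (.inr (.inr (.inr (.inr (.inr (.inr (.inr (.inr (.inl i)))))))))
    | .fillerOut i => .inl (.inr (.inr (.inr (.inr (.inr (.inr (.inr (.inr (.inr (.inl i))))))))))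
    | .rootOut i => .inl (.inr (.inr (.inr (.inr (.inr (.inr (.inr (.inr (.inr (.inr i))))))))))
    | .path i p => .inr (i, p)
  invFun
    | .inl (.inl i) => .sinkRelay i
    | .inl (.inr (.inl i)) => .sourceRelay i
    | .inl (.inr (.inr (.inl i))) => .relayRelay i
    | .inl (.inr (.inr (.inr (.inl i)))) => .fillerIn i
    | .inl (.inr (.inr (.inr (.inr (.inl i))))) => .enter i
    | .inl (.inr (.inr (.inr (.inr (.inr (.inl i)))))) => .leave i
    | .inl (.inr (.inr (.inr (.inr (.inr (.inr (.inl i))))))) => .link i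
    | .inl (.inr (.inr (.inr (.inr (.inr (.inr (.inr (.inl i)))))))) => .relayOut i
    | .inl (.inr (.inr (.inr (.inr (.inr (.inr (.inr (.inr (.inl i))))))))) => .sourceOut i
    | .inl (.inr (.inr (.inr (.inr (.inr (.inr (.inr (.inr (.inr (.inl i)))))))))) => .fillerOut i
    | .inl (.inr (.inr (.inr (.inr (.inr (.inr (.inr (.inr (.inr (.inr i)))))))))) => .rootOut i
    | .inr (i, p) => .path i p
  left_inv := by rintro (_ | _ | _ | _ | _ | _ | _ | _ | _ | _ | _ | _) <;> rfl
  right_inv := by rintro ((_ | _ | _ | _ | _ | _ | _ | _ | _ | _ | _) | _) <;> rfl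

noncomputable instance : Fintype (Edge r) := Fintype.ofEquiv _ (edgeEquiv r).symm

theorem card_edge (r : ℕ) : Fintype.card (Edge r) = 10 * r + 17 + (r + 2) * (2 * r + 3) := by
  rw [Fintype.card_congr (edgeEquiv r)]
  simp only [Fintype.card_sum, Fintype.card_prod, Fintype.card_fin]
  ring

/-- The vertex at position `p` of the `i`-th Hamiltonian path. -/
noncomputable def node (i : Fin (r + 2)) (p : ℕ) (hp : p < 2 * (r + 2)) : Vert r :=
  .core (hamPath (r + 2) i ⟨p, hp⟩)

/-- The time at which the edges around the `i`-th Hamiltonian path begin to appear. -/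
def start (r i : ℕ) : ℕ := r + 3 + i * (2 * r + 6)

theorem start_succ (r i : ℕ) : start r (i + 1) = start r i + (2 * r + 6) := by
  simp only [start]; ring

theorem start_ge (r i : ℕ) : r + 3 ≤ start r i := Nat.le_add_right _ _

theorem start_lt {i j : ℕ} (h : i < j) : start r i + (2 * r + 6) ≤ start r j := by
  rw [← start_succ]
  exact Nat.add_le_add_left (Nat.mul_le_mul_right _ h) _

/-- Fillers bring the number of vertices to `3 * n`. `rootOut 1` only pads the edge count;
reachability needs just `rootOut 0`. -/
noncomputable def ends : Edge r → Vert r × Vert r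
  | .sinkRelay i => (.sink i.succ, .relay i)
  | .sourceRelay i => (.source i.succ, .relay i)
  | .relayRelay i => (.relay i.succ, .relay i.castSucc)
  | .fillerIn l => (.filler l, .core (l.1 : ℕ))
  | .enter i => (.source i, node i 0 (by omega))
  | .path i p => (node i p (by omega), node i (p + 1) (by omega))
  | .leave i => (node i (2 * r + 3) (by omega), .sink i)
  | .link i => (.sink i.castSucc, .source i.succ)
  | .relayOut i => (.relay i.succ, .sink i.castSucc.castSucc)
  | .sourceOut i => (node i (2 * r + 3) (by omega), .source i)
  | .fillerOut l => (.filler l, .core (l.1 + 1 : ℕ))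
  | .rootOut a => (.relay 0, .core (a.1 : ℕ))

/-- Labels between relays decrease with the index, so that long journeys along relays only descend.
A window has `2 * r + 6` slots: `enter`, `2 * r + 3` path edges, `leave`, `link`. The two `rootOut`
edges share a relay and so need different labels. -/
def time : Edge r → ℕ
  | .sinkRelay _ => 1
  | .sourceRelay _ => 2
  | .relayRelay i => r + 2 - i
  | .fillerIn _ => 1
  | .enter i => start r i
  | .path i p => start r i + 1 + p
  | .leave i => start r i + (2 * r + 4)
  | .link i => start r i + (2 * r + 5)
  | .relayOut _ => start r (r + 2)
  | .sourceOut _ => start r (r + 2)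
  | .fillerOut _ => start r (r + 2) + 1
  | .rootOut a => start r (r + 2) + 1 + a

theorem core_natCast_inj {a b : ℕ} (ha : a < 2 * (r + 2)) (hb : b < 2 * (r + 2)) :
    (Vert.core (a : ZMod (2 * (r + 2))) = .core (b : ZMod (2 * (r + 2)))) ↔ a = b := by
  rw [Vert.core.injEq, natCast_zmod_inj ha hb]

theorem time_le (e : Edge r) : time e ≤ start r (r + 2) + 2 := by
  cases e with
  | path i p => have := start_lt (r := r) i.2; have := p.2; simp only [time]; omega
  | enter i => have := start_lt (r := r) i.2; simp only [time]; omega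
  | leave i => have := start_lt (r := r) i.2; simp only [time]; omega
  | link i =>
    have := start_lt (r := r) (show i.1 < r + 2 by omega); simp only [time]; omega
  | _ => have := start_ge r (r + 2); simp only [time]; omega

theorem one_le_time (e : Edge r) : 1 ≤ time e := by
  cases e with
  | enter i => have := start_ge r i; simp only [time]; omega
  | relayRelay i => have := i.2; simp only [time]; omega
  | _ => have := start_ge r (r + 2); simp only [time]; omega

theorem ends_ne (e : Edge r) : (ends e).1 ≠ (ends e).2 := by
  cases e <;> simp [ends, node, Fin.ext_iff]

theorem ends_injective :
    Function.Injective fun e : Edge r => s((ends e).1, (ends e).2) := by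
  intro e e' h
  cases e with
  | path i p =>
    cases e' with
    | path j q =>
      have := hamPath_edge_inj i.2 j.2 (p := ⟨p, by omega⟩) (p' := ⟨p + 1, by omega⟩)
        (q := ⟨q, by omega⟩) (q' := ⟨q + 1, by omega⟩) rfl rfl
        (by simpa [ends, node] using h)
      simpa [Fin.ext_iff] using this
    | _ => simp [ends, node] at h
  | fillerIn l =>
    cases e' with
    | fillerOut l' =>
      simp only [ends, Sym2.eq_iff, Vert.filler.injEq, reduceCtorEq, or_false,
        and_false] at h
      obtain ⟨rfl, h⟩ := h
      rw [core_natCast_inj (by omega) (by omega)] at h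
      omega
    | _ => simp [ends, node] at h ⊢ <;> exact h.1
  | fillerOut l =>
    cases e' with
    | fillerIn l' =>
      simp only [ends, Sym2.eq_iff, Vert.filler.injEq, reduceCtorEq, or_false,
        and_false] at h
      obtain ⟨rfl, h⟩ := h
      rw [core_natCast_inj (by omega) (by omega)] at h
      omega
    | _ => simp [ends, node] at h ⊢ <;> exact h.1
  | rootOut a =>
    cases e' with
    | rootOut a' =>
      simp only [ends, Sym2.congr_right] at h
      rw [core_natCast_inj (by omega) (by omega)] at h
      rw [Fin.ext h]
    | _ => simp [ends, node] at h
  | enter i =>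
    cases e' with
    | sourceOut j =>
      simp only [ends, node, Sym2.eq_iff, reduceCtorEq, false_and, false_or,
        Vert.source.injEq] at h
      obtain ⟨rfl, h⟩ := h
      simp at h
    | _ => simp [ends, node] at h ⊢ <;> exact h.1
  | sourceOut i =>
    cases e' with
    | enter j =>
      simp only [ends, node, Sym2.eq_iff, reduceCtorEq, and_false, false_or,
        Vert.source.injEq] at h
      obtain ⟨h, rfl⟩ := h
      simp at h
    | _ => simp [ends, node] at h ⊢ <;> exact h.2
  | _ => cases e' <;> simp [ends, node] at h ⊢ <;> grind

/-! ### Properness of the labelling -/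

/-- Whether an edge appears before, around or after the Hamiltonian paths, and around which. -/
def stage : Edge r → ℕ
  | .sinkRelay _ | .sourceRelay _ | .relayRelay _ | .fillerIn _ => 0
  | .enter i | .path i _ | .leave i => i + 1
  | .link i => i + 1
  | .relayOut _ | .sourceOut _ | .fillerOut _ | .rootOut _ => r + 3

theorem start_mono {i j : ℕ} (h : i ≤ j) : start r i ≤ start r j :=
  Nat.add_le_add_left (Nat.mul_le_mul_right _ h) _

theorem stage_le (e : Edge r) : stage e ≤ r + 3 := by
  cases e <;> simp only [stage] <;> omega

theorem time_lt_start (e : Edge r) (h : stage e ≤ r + 2) : time e < start r (stage e) := by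
  cases e <;> simp only [stage, time] at h ⊢ <;>
    first
    | omega
    | (rw [start_succ]; omega)
    | (have := start_ge r 0; omega)

theorem start_le_time (e : Edge r) {s : ℕ} (h : s < stage e) : start r s ≤ time e := by
  have key : start r (stage e - 1) ≤ time e := by
    have hr : r + 3 - 1 = r + 2 := rfl
    cases e <;> simp only [stage, time, hr, Nat.add_sub_cancel] at h ⊢ <;> omega
  exact (start_mono (by omega)).trans key

theorem stage_eq {e e' : Edge r} (h : time e = time e') : stage e = stage e' := by
  have aux : ∀ e e' : Edge r, time e = time e' → ¬ stage e < stage e' := by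
    intro e e' h hlt
    have h₁ := time_lt_start e (by have := stage_le e'; omega)
    have h₂ := start_le_time e' hlt
    omega
  have h₁ := aux e e' h
  have h₂ := aux e' e h.symm
  omega

/-- Equal labels put both edges into one stage, where the few coincidences are between disjoint
edges: distinct paths end in distinct core vertices, and `fillerOut` never meets core vertex `0`,
the end of `rootOut 0`. -/
theorem eq_of_time_eq (e e' : Edge r) (ht : time e = time e')
    (h : ∃ v, v ∈ s((ends e).1, (ends e).2) ∧ v ∈ s((ends e').1, (ends e').2)) : e = e' := by
  obtain ⟨v, h, h'⟩ := h
  have hs := stage_eq ht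
  have hc : ∀ a b : ℕ, a < 2 * (r + 2) → b < 2 * (r + 2) →
      (a : ZMod (2 * (r + 2))) = b → a = b := fun a b ha hb => (natCast_zmod_inj ha hb).1
  have hn : ∀ (i j : Fin (r + 2)) (hp : 2 * r + 3 < 2 * (r + 2)),
      hamPath (r + 2) i ⟨2 * r + 3, hp⟩ = hamPath (r + 2) j ⟨2 * r + 3, hp⟩ → i = j :=
    fun i j hp h => Fin.ext ((hamPath_left_inj i.2 j.2 _).1 h)
  have hl : ∀ (l : Fin (r + 3)) (a : Fin 2), (l.1 : ZMod (2 * (r + 2))) + 1 = (a.1 : ℕ) →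
      l.1 + 1 = a := fun l a h => hc _ _ (by omega) (by omega) (by push_cast; exact h)
  have hr : ∀ i j : Fin r, i.castSucc.castSucc = j.castSucc.castSucc → i = j :=
    fun i j h => by simpa using h
  rw [Sym2.mem_iff] at h h'
  cases e <;> cases e' <;> simp only [stage, time] at hs ht <;>
    first
    | omega
    | (simp only [ends, node] at h h'; grind)

/-- The dense example. -/
noncomputable def dense (r : ℕ) : TemporalGraph (Vert r) := ofFamily ends time ends_ne

/-! ### Temporal connectivity -/

section Reach

variable {u : Vert r}

theorem start_lt_end (i : Fin (r + 2)) : start r i + (2 * r + 6) ≤ start r (r + 2) :=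
  start_lt i.2

theorem exists_eq_node (k : ZMod (2 * (r + 2))) (i : Fin (r + 2)) :
    ∃ p hp, Vert.core k = node i p hp :=
  ⟨(hamPath (r + 2) i).symm k, Fin.is_lt _, by simp [node]⟩

theorem reachBy_node {i : Fin (r + 2)} {p q t : ℕ} (hp : p < 2 * (r + 2))
    (h : (dense r).ReachBy u (node i p hp) t) (ht : t ≤ start r i + p) (hpq : p ≤ q)
    (hq : q < 2 * (r + 2)) : (dense r).ReachBy u (node i q hq) (start r i + q) := by
  induction q, hpq using Nat.le_induction with
  | base => exact h.mono ht
  | succ q hpq ih =>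
    exact ((ih (by omega)).fwd (.path i ⟨q, by omega⟩) rfl
      (by simp only [time]; omega)).mono (by simp only [time]; omega)

theorem reachBy_last {k : ZMod (2 * (r + 2))} {t : ℕ} (h : (dense r).ReachBy u (.core k) t)
    (i : Fin (r + 2)) (ht : t ≤ start r i) :
    (dense r).ReachBy u (node i (2 * r + 3) (by omega)) (start r i + (2 * r + 3)) := by
  obtain ⟨p, hp, hk⟩ := exists_eq_node k i
  rw [hk] at h
  exact reachBy_node hp h (by omega) (by omega) _

theorem reachBy_sink {k : ZMod (2 * (r + 2))} {t : ℕ} (h : (dense r).ReachBy u (.core k) t)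
    (i : Fin (r + 2)) (ht : t ≤ start r i) :
    (dense r).ReachBy u (.sink i) (start r i + (2 * r + 4)) :=
  (reachBy_last h i ht).fwd (.leave i) rfl (by simp only [time]; omega)

theorem reachBy_core {i : Fin (r + 2)} {t : ℕ} (h : (dense r).ReachBy u (.source i) t)
    (ht : t ≤ start r i) (k : ZMod (2 * (r + 2))) :
    (dense r).ReachBy u (.core k) (start r i + (2 * r + 3)) := by
  obtain ⟨p, hp, hk⟩ := exists_eq_node k i
  rw [hk]
  exact (reachBy_node _ (h.fwd (.enter i) rfl ht) le_rfl (Nat.zero_le _) hp).mono (by omega)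

theorem reachBy_sink_of_source {i j : Fin (r + 2)} {t : ℕ}
    (h : (dense r).ReachBy u (.source i) t) (ht : t ≤ start r i) (hij : i ≤ j) :
    (dense r).ReachBy u (.sink j) (start r (r + 2)) := by
  have hj := start_lt_end j
  rcases hij.eq_or_lt with rfl | hij
  · exact ((reachBy_node (by omega) (h.fwd (.enter i) rfl ht) le_rfl (Nat.zero_le _)
      (q := 2 * r + 3) (by omega)).fwd (.leave i) rfl (by simp only [time]; omega)).mono
      (by simp only [time]; omega)
  · have := start_lt (r := r) (Fin.lt_def.1 hij)
    exact (reachBy_sink (reachBy_core h ht 0) j (by omega)).mono (by omega)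

theorem reachBy_relay {l l' : Fin (r + 1)} (h : (dense r).ReachBy u (.relay l) 2) (hl : l' ≤ l) :
    (dense r).ReachBy u (.relay l') (start r (r + 2)) := by
  -- The bound `r + 2 - l'` is the label of the edge entering relay `l'` from above.
  suffices key : ∀ d (l' : Fin (r + 1)), l'.1 + d = l.1 →
      (dense r).ReachBy u (.relay l') (r + 2 - l') by
    have := start_ge r (r + 2)
    have hl : l'.1 ≤ l.1 := hl
    exact (key (l.1 - l'.1) l' (by omega)).mono (by omega)
  intro d
  induction d with
  | zero =>
    intro l' hd
    obtain rfl : l' = l := Fin.ext hd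
    exact h.mono (by omega)
  | succ d ih =>
    intro l' hd
    have := l.2
    have hl' : l' = (⟨l'.1, by omega⟩ : Fin r).castSucc := rfl
    have hs := ih (⟨l'.1, by omega⟩ : Fin r).succ (by rw [Fin.val_succ]; simp only; omega)
    rw [hl']
    exact hs.fwd (.relayRelay ⟨l'.1, by omega⟩) rfl (by simp only [time, Fin.val_succ]; omega)

/-- The late edges finish the job: sources, fillers and relay `0` hang on the core, and `relayOut`
makes sink `l` and relay `l + 1` interchangeable, whence the disjunction. -/
theorem canReach_of_reachBy_core (hcore : ∀ k, (dense r).ReachBy u (.core k) (start r (r + 2)))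
    (hsink : ∀ j, (dense r).ReachBy u (.sink j) (start r (r + 2)) ∨
      ∃ l : Fin r, j = l.castSucc.castSucc ∧ (dense r).ReachBy u (.relay l.succ) (start r (r + 2)))
    (v : Vert r) : (dense r).CanReach u v := by
  cases v with
  | core k => exact (hcore k).canReach
  | source i => exact ((hcore _).fwd (.sourceOut i) rfl le_rfl).canReach
  | sink j =>
    rcases hsink j with h | ⟨l, rfl, h⟩
    · exact h.canReach
    · exact (h.fwd (.relayOut l) rfl le_rfl).canReach
  | relay l =>
    cases l using Fin.cases with
    | zero =>
      exact ((hcore ((0 : Fin 2).1 : ℕ)).bwd (.rootOut 0) rfl (by simp only [time]; omega)).canReach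
    | succ l =>
      rcases hsink l.castSucc.castSucc with h | ⟨l', hl, h⟩
      · exact (h.bwd (.relayOut l) rfl le_rfl).canReach
      · obtain rfl : l = l' := by simpa using hl
        exact h.canReach
  | filler l => exact ((hcore _).bwd (.fillerOut l) rfl (by simp only [time]; omega)).canReach

/-- Sinks from `i` on are served by path `i` and later windows, sink `i - 1` by its link, and each
lower sink `j` by relay `j + 1`. -/
theorem canReach_of_source {i : Fin (r + 2)} (h : (dense r).ReachBy u (.source i) 2)
    (hrelay : ∀ l : Fin (r + 1), l.succ ≤ i → (dense r).ReachBy u (.relay l) (start r (r + 2)))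
    (v : Vert r) : (dense r).CanReach u v := by
  have hi := start_lt_end i
  have h2 := start_ge r i
  refine canReach_of_reachBy_core (fun k => (reachBy_core h (by omega) k).mono (by omega))
    (fun j => ?_) v
  rcases le_or_gt i j with hij | hij
  · exact .inl (reachBy_sink_of_source h (by omega) hij)
  · have hij : j.1 < i.1 := hij
    rcases Nat.lt_or_ge (j.1 + 1) i.1 with hj | hj
    · exact .inr ⟨⟨j, by omega⟩, rfl, hrelay _ (Fin.le_def.2 hj)⟩
    · left
      have hi' : i = (⟨j, by omega⟩ : Fin (r + 1)).succ := Fin.ext (by simp; omega)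
      have hj' : j = (⟨j, by omega⟩ : Fin (r + 1)).castSucc := rfl
      have h3 := start_ge r j
      have h4 := start_lt_end j
      rw [hi'] at h
      rw [hj']
      exact (h.bwd (.link ⟨j, by omega⟩) rfl (by simp only [time]; omega)).mono
        (by simp only [time]; omega)

theorem canReach_of_relay {l : Fin (r + 1)} (h : (dense r).ReachBy u (.relay l) 2) (v : Vert r) :
    (dense r).CanReach u v :=
  canReach_of_source (h.bwd (.sourceRelay l) rfl le_rfl)
    (fun _ hl => reachBy_relay h (Fin.succ_le_succ_iff.1 hl)) v

/-- `link 0` appears one step before window `1`, so source `1` can still enter its path and cover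
the core and all sinks but `0`. -/
theorem canReach_of_source_one (h0 : (dense r).ReachBy u (.sink 0) (start r 0 + (2 * r + 4)))
    (v : Vert r) : (dense r).CanReach u v := by
  have h1 : (dense r).ReachBy u (.source 1) (start r 0 + (2 * r + 5)) :=
    h0.fwd (.link 0) rfl (by simp [time])
  have h01 : start r 1 = start r 0 + (2 * r + 6) := start_succ r 0
  have h1' : start r 1 + (2 * r + 6) ≤ start r (r + 2) := start_lt (by omega)
  refine canReach_of_reachBy_core (fun k => (reachBy_core h1 (by simp; omega) k).mono
    (by simp; omega)) (fun j => .inl ?_) v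
  rcases eq_or_ne j 0 with rfl | hj
  · exact h0.mono (by omega)
  · exact reachBy_sink_of_source h1 (by simp; omega) (Fin.one_le_of_ne_zero hj)

theorem canReach_of_core {k : ZMod (2 * (r + 2))} {t : ℕ} (h : (dense r).ReachBy u (.core k) t)
    (ht : t ≤ start r 0) (v : Vert r) : (dense r).CanReach u v :=
  canReach_of_source_one (reachBy_sink h 0 ht) v

end Reach

theorem temporallyConnected_dense (r : ℕ) : (dense r).TemporallyConnected := by
  intro u v
  have hu : (dense r).ReachBy u u 0 := .refl _ _ _
  cases u with
  | core k => exact canReach_of_core hu (Nat.zero_le _) v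
  | source i =>
    cases i using Fin.cases with
    | zero => exact canReach_of_source (hu.mono (by omega)) (fun l hl => absurd hl (by simp)) v
    | succ l => exact canReach_of_relay (hu.fwd (.sourceRelay l) rfl (Nat.zero_le _)) v
  | sink i =>
    cases i using Fin.cases with
    | zero => exact canReach_of_source_one (hu.mono (Nat.zero_le _)) v
    | succ l =>
      exact canReach_of_relay ((hu.fwd (.sinkRelay l) rfl (Nat.zero_le _)).mono
        (by simp [time])) v
  | relay l => exact canReach_of_relay (hu.mono (by omega)) v
  | filler l =>
    exact canReach_of_core (hu.fwd (.fillerIn l) rfl (Nat.zero_le _))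
      (by have := start_ge r 0; simp only [time]; omega) v

/-! ### Indispensability of the path edges -/

/-- A lower bound for the times at which the vertices are reached from the source of the `i`-th
Hamiltonian path when the `p`-th edge of this path is missing. -/
noncomputable def arrival (i : Fin (r + 2)) (p : ℕ) : Vert r → ℕ
  | .core k =>
    if ((hamPath (r + 2) i).symm k).1 ≤ p then start r i + ((hamPath (r + 2) i).symm k).1
    else start r (i + 1)
  | .source j => if j = i then 0 else start r (i + 1)
  | .sink j =>
    if j.1 + 1 = i then start r i - 1 else if j = i then start r (r + 2) + 3 else start r (i + 1)
  | .relay j =>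
    if j.1 + 1 < i then 3 else if j.1 + 1 = i then 2 else if j.1 = i then r + 3 - i
    else if j.1 = i + 1 then start r (r + 2) + 1 else start r (r + 2)
  | .filler _ => start r (i + 1)

theorem arrival_node (i : Fin (r + 2)) (p q : ℕ) (hq : q < 2 * (r + 2)) :
    arrival i p (node i q hq) = if q ≤ p then start r i + q else start r (i + 1) := by
  simp [arrival, node]

theorem start_le_arrival_core (i : Fin (r + 2)) (p : ℕ) (k : ZMod (2 * (r + 2))) :
    start r i ≤ arrival i p (.core k) := by
  rw [arrival, start_succ]
  split_ifs <;> omega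

theorem arrival_core_le (i : Fin (r + 2)) (p : ℕ) (k : ZMod (2 * (r + 2))) :
    arrival i p (.core k) ≤ start r i + (2 * r + 6) := by
  have := ((hamPath (r + 2) i).symm k).2
  rw [arrival, start_succ]
  split_ifs <;> omega

/-- Beyond the gap, the core opens only with the next window, too late for `leave i` and `link i`.
Relays offer no detour: relay `i` is available at `r + 3 - i`, one step after its edge to relay `i +
1`, so relay `i + 1` misses `relayOut` to sink `i`. -/
theorem arrival_le_iff (i : Fin (r + 2)) (p : Fin (2 * r + 3)) (e : Edge r)
    (he : e ≠ .path i p) :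
    arrival i p (ends e).1 ≤ time e ↔ arrival i p (ends e).2 ≤ time e := by
  have hi := start_lt_end i
  have hg := start_ge r i
  have hs := start_succ r i
  have hc := fun k => start_le_arrival_core i p k
  have hc' := fun k => arrival_core_le i p k
  cases e with
  | sinkRelay j =>
    simp only [ends, time, arrival, Fin.val_succ, Fin.ext_iff]
    split_ifs <;> omega
  | sourceRelay j =>
    simp only [ends, time, arrival, Fin.val_succ, Fin.ext_iff]
    split_ifs <;> omega
  | relayRelay j =>
    simp only [ends, time, arrival, Fin.val_succ, Fin.val_castSucc]
    split_ifs <;> omega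
  | fillerIn l =>
    have := hc (l.1 : ℕ)
    simp only [ends, time]
    simp only [arrival] at this ⊢
    omega
  | fillerOut l =>
    have := hc' (l.1 + 1 : ℕ)
    simp only [ends, time]
    simp only [arrival] at this ⊢
    omega
  | rootOut a =>
    have := hc' (a.1 : ℕ)
    simp only [ends, time]
    generalize arrival i p (.core _) = A at this ⊢
    simp only [arrival, Fin.val_zero]
    split_ifs <;> omega
  | relayOut j =>
    simp only [ends, time, arrival, Fin.val_succ, Fin.val_castSucc, Fin.ext_iff]
    split_ifs <;> omega
  | sourceOut j =>
    have := hc' (hamPath (r + 2) j ⟨2 * r + 3, by omega⟩)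
    simp only [ends, time, node]
    generalize arrival i p (.core _) = A at this ⊢
    simp only [arrival]
    split_ifs <;> omega
  | link j =>
    simp only [ends, time, arrival, Fin.val_succ, Fin.val_castSucc, Fin.ext_iff]
    have hj := start_succ r j
    rcases lt_trichotomy j.1 i.1 with h | h | h
    · have h1 := start_lt (r := r) h
      rcases Nat.lt_or_ge (j.1 + 1) i.1 with h' | h'
      · have h2 := start_lt (r := r) h'
        split_ifs <;> omega
      · have h2 : j.1 + 1 = i.1 := by omega
        rw [h2] at hj
        split_ifs; omega
    · rw [h]
      split_ifs <;> omega
    · have h1 := start_lt (r := r) h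
      split_ifs <;> omega
  | enter j =>
    rcases lt_trichotomy j.1 i.1 with h | h | h
    · have h1 := start_lt (r := r) h
      have := hc (hamPath (r + 2) j ⟨0, by omega⟩)
      simp only [ends, time, node]
      generalize arrival i p (.core _) = A at this ⊢
      simp only [arrival, Fin.ext_iff]
      split_ifs <;> omega
    · obtain rfl := Fin.ext h
      simp [ends, time, arrival_node]
      simp [arrival]
    · have h1 := start_lt (r := r) h
      have := hc' (hamPath (r + 2) j ⟨0, by omega⟩)
      simp only [ends, time, node]
      generalize arrival i p (.core _) = A at this ⊢
      simp only [arrival, Fin.ext_iff]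
      split_ifs <;> omega
  | leave j =>
    rcases lt_trichotomy j.1 i.1 with h | h | h
    · have h1 := start_lt (r := r) h
      have := hc (hamPath (r + 2) j ⟨2 * r + 3, by omega⟩)
      simp only [ends, time, node]
      generalize arrival i p (.core _) = A at this ⊢
      simp only [arrival, Fin.ext_iff]
      split_ifs <;> omega
    · obtain rfl := Fin.ext h
      simp only [ends, time, arrival_node]
      simp only [arrival]
      split_ifs <;> omega
    · have h1 := start_lt (r := r) h
      have := hc' (hamPath (r + 2) j ⟨2 * r + 3, by omega⟩)
      simp only [ends, time, node]
      generalize arrival i p (.core _) = A at this ⊢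
      simp only [arrival, Fin.ext_iff]
      split_ifs <;> omega
  | path j q =>
    rcases lt_trichotomy j.1 i.1 with h | h | h
    · have h1 := start_lt (r := r) h
      have h2 := hc (hamPath (r + 2) j ⟨q, by omega⟩)
      have h3 := hc (hamPath (r + 2) j ⟨q + 1, by omega⟩)
      simp only [ends, time, node]
      omega
    · obtain rfl := Fin.ext h
      have hq : q.1 ≠ p.1 := fun h => he (by rw [Fin.ext h])
      simp only [ends, time, arrival_node]
      split_ifs <;> omega
    · have h1 := start_lt (r := r) h
      have h2 := hc' (hamPath (r + 2) j ⟨q, by omega⟩)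
      have h3 := hc' (hamPath (r + 2) j ⟨q + 1, by omega⟩)
      simp only [ends, time, node]
      omega

/-- The edges of the Hamiltonian paths cannot be removed from the dense example. -/
theorem not_temporallyConnected_dense {S : Set (Sym2 (Vert r))} (i : Fin (r + 2))
    (p : Fin (2 * r + 3)) (hS : s((ends (.path i p)).1, (ends (.path i p)).2) ∈ S) :
    ¬ ((dense r).removeEdges S).TemporallyConnected :=
  not_temporallyConnected_of_barrier hS time_le (arrival_le_iff i p)
    -- The value at the sink is `start r (r + 2) + 3`, just above every label.
    (u := .source i) (v := .sink i) (by simp [arrival]) (by simp [arrival])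

/-- Only few edges of the dense example lie outside the Hamiltonian paths. -/
theorem ncard_le_of_temporallyConnected {S : Set (Sym2 (Vert r))} (hS : S ⊆ (dense r).edges)
    (h : ((dense r).removeEdges S).TemporallyConnected) : S.ncard ≤ 10 * r + 17 := by
  let f := fun e : Edge r => s((ends e).1, (ends e).2)
  have hsub : S ⊆ (fun a => f ((edgeEquiv r).symm (.inl a))) '' Set.univ := by
    intro e he
    have he' := hS he
    rw [dense, edges_ofFamily] at he'
    obtain ⟨e, rfl⟩ := he'
    obtain ⟨a | ⟨i, p⟩, rfl⟩ := (edgeEquiv r).symm.surjective e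
    · exact ⟨a, trivial, rfl⟩
    · exact absurd h (not_temporallyConnected_dense i p he)
  refine (Set.ncard_le_ncard hsub (Set.toFinite _)).trans ((Set.ncard_image_le).trans ?_)
  rw [Set.ncard_univ, Nat.card_eq_fintype_card]
  simp only [Fintype.card_sum, Fintype.card_fin]
  omega

end Dense

/-! ### The case `n = 2`, not covered by `m = r + 2` -/

section Small

/-- On the four-cycle, labels `2` and `3` spread everything among vertices `0` to `3`; vertices `4`
and `5` send at time `1` and receive at time `4`. -/
def smallEnds : Fin 8 → Fin 6 × Fin 6 :=
  ![(4, 0), (5, 1), (0, 1), (2, 3), (0, 2), (1, 3), (4, 1), (5, 0)]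

def smallTime : Fin 8 → ℕ := ![1, 1, 2, 2, 3, 3, 4, 4]

/-- A temporally connected happy graph with six vertices and eight edges. -/
def small : TemporalGraph (Fin 6) := ofFamily smallEnds smallTime (by decide)

theorem temporallyConnected_small : small.TemporallyConnected := by
  have finish : ∀ u, ReachBy small u 0 3 → ReachBy small u 1 3 → ReachBy small u 2 3 →
      ReachBy small u 3 3 → ∀ v, small.CanReach u v := by
    intro u h0 h1 h2 h3 v
    fin_cases v
    · exact h0.canReach
    · exact h1.canReach
    · exact h2.canReach
    · exact h3.canReach
    · exact (h1.bwd 6 rfl (by decide)).canReach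
    · exact (h0.bwd 7 rfl (by decide)).canReach
  have left : ∀ u, ReachBy small u 0 2 → ReachBy small u 1 2 → ∀ v, small.CanReach u v :=
    fun u h0 h1 => finish u (h0.mono (by decide)) (h1.mono (by decide))
      (h0.fwd 4 rfl (by decide)) (h1.fwd 5 rfl (by decide))
  have right : ∀ u, ReachBy small u 2 2 → ReachBy small u 3 2 → ∀ v, small.CanReach u v :=
    fun u h2 h3 => finish u (h2.bwd 4 rfl (by decide)) (h3.bwd 5 rfl (by decide))
      (h2.mono (by decide)) (h3.mono (by decide))
  intro u
  have hu : ReachBy small u u 0 := .refl _ _ _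
  fin_cases u
  · exact left _ (hu.mono (by decide)) (hu.fwd 2 rfl (by decide))
  · exact left _ (hu.bwd 2 rfl (by decide)) (hu.mono (by decide))
  · exact right _ (hu.mono (by decide)) (hu.fwd 3 rfl (by decide))
  · exact right _ (hu.bwd 3 rfl (by decide)) (hu.mono (by decide))
  · have h0 := hu.fwd 0 rfl (by decide)
    exact left _ (h0.mono (by decide)) (h0.fwd 2 rfl (by decide))
  · have h1 := hu.fwd 1 rfl (by decide)
    exact left _ (h1.bwd 2 rfl (by decide)) (h1.mono (by decide))

theorem smallEnds_injective :
    Function.Injective fun i => s((smallEnds i).1, (smallEnds i).2) := by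
  decide

theorem happy_small : small.Happy :=
  happy_ofFamily smallEnds_injective (by decide)

end Small

/-! ### Assembly and the consequence for spanners -/

/-- For every even `n ≥ 2` there is a happy graph on `3 * n` vertices all of whose temporal
spanners have about `n ^ 2 / 2` edges. -/
theorem exists_dense (n : ℕ) (hn : Even n) (h2 : 2 ≤ n) :
    ∃ (V : Type) (_ : Fintype V) (G : TemporalGraph V),
      Fintype.card V = 3 * n ∧
      G.Happy ∧ G.TemporallyConnected ∧
      G.edges.ncard = n * (n + 9) / 2 - 3 ∧
      G.lifetime ⊆ Set.Icc 1 (n * (n + 5) / 2 - 1) ∧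
      ∀ S : Set (Sym2 V), S ⊆ G.edges → S.ncard = 5 * n →
        ¬ (G.removeEdges S).TemporallyConnected := by
  obtain ⟨m, rfl⟩ := hn
  obtain rfl | ⟨r, rfl⟩ : m = 1 ∨ ∃ r, m = r + 2 := by
    rcases Nat.lt_or_ge m 2 with h | h
    · left; omega
    · exact .inr ⟨m - 2, by omega⟩
  · have hcard : small.edges.ncard = 8 := by
      rw [small, ncard_edges_ofFamily smallEnds_injective]
      simp
    refine ⟨Fin 6, inferInstance, small, by simp, happy_small, temporallyConnected_small,
      hcard, lifetime_ofFamily_subset (by decide), ?_⟩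
    -- Vacuous: `S` would need ten of only eight edges.
    intro S hS hc
    have := Set.ncard_le_ncard hS (Set.toFinite _)
    omega
  · have hE : (r + 2 + (r + 2)) * (r + 2 + (r + 2) + 9) / 2 - 3
        = 10 * r + 17 + (r + 2) * (2 * r + 3) := by
      rw [show (r + 2 + (r + 2)) * (r + 2 + (r + 2) + 9)
        = 2 * (10 * r + 17 + (r + 2) * (2 * r + 3) + 3) by ring]
      omega
    have hT : (r + 2 + (r + 2)) * (r + 2 + (r + 2) + 5) / 2 - 1
        = Dense.start r (r + 2) + 2 + 2 * r := by
      rw [show (r + 2 + (r + 2)) * (r + 2 + (r + 2) + 5)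
        = 2 * (Dense.start r (r + 2) + 2 + 2 * r + 1) by simp only [Dense.start]; ring]
      omega
    refine ⟨Dense.Vert r, inferInstance, Dense.dense r, ?_,
      happy_ofFamily Dense.ends_injective Dense.eq_of_time_eq,
      Dense.temporallyConnected_dense r, ?_, lifetime_ofFamily_subset fun e => ?_, ?_⟩
    · rw [Dense.card_vert]; ring
    · rw [Dense.dense, ncard_edges_ofFamily Dense.ends_injective, Nat.card_eq_fintype_card,
        Dense.card_edge, hE]
    · have := Dense.time_le e
      exact ⟨Dense.one_le_time e, by omega⟩
    · intro S hS hc h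
      have := Dense.ncard_le_of_temporallyConnected hS h
      omega

/-- A spanner with few edges avoids some set of `k` edges, which can then be removed. -/
theorem IsSpanner.exists_removeEdges {V : Type*} [Finite V] {G H : TemporalGraph V}
    (h : H.IsSpanner G) {k : ℕ} (hk : H.edges.ncard + k ≤ G.edges.ncard) :
    ∃ S ⊆ G.edges, S.ncard = k ∧ (G.removeEdges S).TemporallyConnected := by
  obtain ⟨hconn, hsub, hlabel⟩ := h
  have hd : k ≤ (G.edges \ H.edges).ncard := by
    rw [Set.ncard_sdiff hsub]
    omega
  obtain ⟨S, hS, rfl⟩ := Set.exists_subset_card_eq hd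
  refine ⟨S, hS.trans Set.sdiff_subset, rfl, fun u v => (hconn u v).mono fun e t ht => ?_⟩
  have he : e ∈ H.edges := (H.label_nonempty_iff e).1 ⟨t, ht⟩
  exact mem_label_removeEdges.2 ⟨fun h => (hS h).2 he, hlabel e he ht⟩

end TemporalGraph

theorem mainTheorem2 :
    (∀ n : ℕ, Even n → 2 ≤ n →
      ∃ (V : Type) (_ : Fintype V) (G : TemporalGraph V),
        Fintype.card V = 3 * n ∧
        G.Happy ∧ G.TemporallyConnected ∧
        G.edges.ncard = n * (n + 9) / 2 - 3 ∧
        G.lifetime ⊆ Set.Icc 1 (n * (n + 5) / 2 - 1) ∧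
        ∀ S : Set (Sym2 V), S ⊆ G.edges → S.ncard = 5 * n →
          ¬ (G.removeEdges S).TemporallyConnected) ∧
    ¬ ∃ f : ℕ → ℝ,
        f =o[Filter.atTop] (fun N : ℕ => (N : ℝ) ^ 2) ∧
        ∀ (V : Type) [Fintype V] (G : TemporalGraph V), G.Happy → G.TemporallyConnected →
          ∃ H : TemporalGraph V, H.IsSpanner G ∧ (H.edges.ncard : ℝ) ≤ f (Fintype.card V) := by
  refine ⟨TemporalGraph.exists_dense, ?_⟩
  rintro ⟨f, hf, hspan⟩
  -- There will be `6 * (N + 4)` vertices, so `1 / 36` yields `f ≤ (N + 4) ^ 2`, half the leading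
  -- term of the edge count.
  have hf' := hf.bound (show (0 : ℝ) < 1 / 36 by norm_num)
  obtain ⟨N, hN⟩ := Filter.eventually_atTop.1 hf'
  obtain ⟨V, _, G, hV, hG, hconn, hE, -, hS⟩ :=
    TemporalGraph.exists_dense (2 * (N + 4)) (even_two_mul _) (by omega)
  obtain ⟨H, hH, hle⟩ := hspan V G hG hconn
  have hfN : f (3 * (2 * (N + 4))) ≤ ((N + 4) ^ 2 : ℝ) := by
    have h := hN (3 * (2 * (N + 4))) (by omega)
    rw [Real.norm_eq_abs, Real.norm_eq_abs, abs_of_nonneg (by positivity : (0 : ℝ) ≤ _ ^ 2)] at h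
    refine (le_abs_self _).trans (h.trans (le_of_eq ?_))
    push_cast
    ring
  rw [hV] at hle
  have hcard : H.edges.ncard ≤ (N + 4) ^ 2 := by exact_mod_cast hle.trans hfN
  have hE' : 2 * (N + 4) * (2 * (N + 4) + 9) / 2 - 3 = 2 * (N + 4) ^ 2 + 9 * (N + 4) - 3 := by
    rw [show 2 * (N + 4) * (2 * (N + 4) + 9) = 2 * (2 * (N + 4) ^ 2 + 9 * (N + 4)) by ring]
    omega
  have hsq : (N + 4) ^ 2 = N ^ 2 + 8 * N + 16 := by ring
  -- With `x = N + 4`, the count needs `x ^ 2 + 10 * x ≤ 2 * x ^ 2 + 9 * x - 3`, which holds as `x ≥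
  -- 4`.
  obtain ⟨S, hSE, hSn, hSc⟩ := hH.exists_removeEdges (k := 5 * (2 * (N + 4))) (by omega)
  exact hS S hSE hSn hSc
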